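/- Let $(X,d)$ be a proper geodesic Gromov hyperbolic metric space, let $o\in X$, and let $b>1$ be such that the Gromov boundary $\partial X$ admits a visual metric $D$, i.e. a metric with $D(\xi,\eta)\asymp_\times b^{-\langle\xi|\eta\rangle_o}$, where $\langle\cdot|\cdot\rangle_o$ is the Gromov product (extended to $\partial X$ by the infimum of lower limits along representing sequences). Let $G$ be a subgroup of $\mathrm{Isom}(X)$ that is strongly discrete (for each $r>0$ only finitely many $g\in G$ satisfy $d(o,g(o))\le r$) and of general type (it contains two loxodromic isometries without common fixed points in $\partial X$). Write * $\delta=\inf\{s\ge 0:\sum_{g\in G}b^{-s\,d(o,g(o))}<\infty\}$ for the Poincaré exponent of $G$, assumed to be finite; * $\Lambda\subset\partial X$ for the limit set of $G$, the set of all limits in $\partial X$ of sequences in $G(o)$; * $\Lambda_{\mathrm{ur}}$ for the uniformly radial limit set, the set of all $\eta\in\partial X$ for which there are $\sigma>0$ and a sequence $(g_n)_{n\ge1}$ in $G$ with $g_1(o)=o$, $g_n(o)\to\eta$, and $\langle o|\eta\rangle_{g_n(o)}\le\sigma$ and $d(g_n(o),g_{n+1}(o))\le\sigma$ for all $n$.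 Let $\mu$ be a nonzero finite Borel measure on $\partial X$ with $\mu(\partial X\setminus\Lambda)=0$ that is $\delta$-quasiconformal: there is a constant $C$ such that for all $g\in G$ and all Borel sets $A\subset\partial X$, $$C^{-1}\int_A g'(\xi)^\delta\,d\mu(\xi)\le\mu(g(A))\le C\int_A g'(\xi)^\delta\,d\mu(\xi),\qquad g'(\xi)=b^{\langle g^{-1}(o)|\xi\rangle_o-\langle o|\xi\rangle_{g^{-1}(o)}}.$$ Then $\mu(\Lambda_{\mathrm{ur}})=0$ if and only if $G$ is not quasiconvex-cocompact. Here $G$ is quasiconvex-cocompact if there is $\rho>0$ such that every geodesic segment joining two points of the orbit $G(o)$ is contained in the union of the closed balls of radius $\rho$ centred at points of $G(o)$. -/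

import Mathlib

open Filter Topology MeasureTheory Set
open scoped ENNReal NNReal

namespace Gromov

noncomputable section

/-! ## Hyperbolic metric spaces -/

/-- The Gromov product `⟨x|y⟩_z` of points of a metric space. -/
def gromovProd {X : Type*} [MetricSpace X] (z x y : X) : ℝ :=
  (dist x z + dist y z - dist x y) / 2

/-- A metric space is (Gromov) hyperbolic if Gromov's inequality holds for every four points, up to
a uniform additive constant. -/
class HyperbolicSpace (X : Type*) [MetricSpace X] : Prop where
  exists_const : ∃ C : ℝ, ∀ x y z w : X, min (gromovProd w x y) (gromovProd w y z) - C ≤ gromovProd w x z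

/-- `S` is a geodesic segment joining `x` to `y`: the image of an isometric embedding of the
interval `[0, dist x y]` taking `0` to `x` and `dist x y` to `y`. -/
def IsGeodesicSegment {X : Type*} [MetricSpace X] (x y : X) (S : Set X) : Prop :=
  ∃ γ : ℝ → X, γ 0 = x ∧ γ (dist x y) = y ∧
    (∀ s ∈ Icc 0 (dist x y), ∀ t ∈ Icc 0 (dist x y), dist (γ s) (γ t) = |s - t|) ∧
    S = γ '' Icc 0 (dist x y)

/-- A geodesic metric space: any two points are joined by a geodesic segment. -/
def IsGeodesicSpace (X : Type*) [MetricSpace X] : Prop :=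
  ∀ x y : X, ∃ S : Set X, IsGeodesicSegment x y S

/-! ## The Gromov boundary -/

/-- `x` is a Gromov sequence: `⟨x n|x m⟩_z → ∞` as `n, m → ∞`. (Written for all base points at once;
see `isGromovSeq_iff`.) -/
def IsGromovSeq {X : Type*} [MetricSpace X] (x : ℕ → X) : Prop :=
  ∀ z : X, Tendsto (fun p : ℕ × ℕ => gromovProd z (x p.1) (x p.2)) atTop atTop

lemma gromovProd_le_add {X : Type*} [MetricSpace X] (z w x y : X) :
    gromovProd z x y ≤ gromovProd w x y + dist z w := by
  have h1 := dist_triangle x w z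
  have h2 := dist_triangle y w z
  have h3 := dist_comm w z
  unfold gromovProd
  linarith

lemma gromovProd_isometry {X : Type*} [MetricSpace X] (g : X ≃ᵢ X) (z x y : X) : gromovProd z (g x) (g y) = gromovProd (g⁻¹ z) x y := by
  have h : ∀ u : X, dist (g u) z = dist u (g⁻¹ z) := fun u => by
    rw [← g.dist_eq u (g⁻¹ z), IsometryEquiv.apply_inv_self]
  simp only [gromovProd, h, g.dist_eq]

/-- Change of base point. -/
lemma tendsto_gromovProd_base {X ι : Type*} [MetricSpace X] {l : Filter ι} {x y : ι → X} {o : X}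
    (h : Tendsto (fun i => gromovProd o (x i) (y i)) l atTop) (z : X) :
    Tendsto (fun i => gromovProd z (x i) (y i)) l atTop := by
  refine tendsto_atTop_mono (fun i => ?_) (tendsto_atTop_add_const_right l (-dist o z) h)
  have := gromovProd_le_add o z (x i) (y i)
  linarith

lemma isGromovSeq_iff {X : Type*} [MetricSpace X] (o : X) (x : ℕ → X) :
    IsGromovSeq x ↔ Tendsto (fun p : ℕ × ℕ => gromovProd o (x p.1) (x p.2)) atTop atTop :=
  ⟨fun h => h o, fun h => tendsto_gromovProd_base h⟩

/-- The type of Gromov sequences. -/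
def GromovSeq (X : Type*) [MetricSpace X] : Type _ := {x : ℕ → X // IsGromovSeq x}

/-- Equivalence of Gromov sequences: `⟨x n|y n⟩_z → ∞`. -/
def GromovSeq.Equiv {X : Type*} [MetricSpace X] (x y : GromovSeq X) : Prop :=
  ∀ z : X, Tendsto (fun n => gromovProd z (x.1 n) (y.1 n)) atTop atTop

instance gromovSetoid (X : Type*) [MetricSpace X] [HyperbolicSpace X] : Setoid (GromovSeq X) where
  r := GromovSeq.Equiv
  iseqv :=
    { refl := fun x z => (x.2 z).comp tendsto_atTop_diagonal
      symm := by
        intro x y h z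
        have e : (fun n => gromovProd z (y.1 n) (x.1 n)) = fun n => gromovProd z (x.1 n) (y.1 n) := by
          funext n
          simp only [gromovProd, dist_comm (y.1 n) (x.1 n)]
          ring
        rw [e]
        exact h z
      trans := by
        intro x y w hxy hyw z
        obtain ⟨C, hC⟩ := HyperbolicSpace.exists_const (X := X)
        have h : Tendsto (fun n => min (gromovProd z (x.1 n) (y.1 n)) (gromovProd z (y.1 n) (w.1 n)))
            atTop atTop := by
          rw [tendsto_atTop]
          intro b
          filter_upwards [(tendsto_atTop.1 (hxy z)) b, (tendsto_atTop.1 (hyw z)) b] with n h1 h2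
          exact le_min h1 h2
        refine tendsto_atTop_mono (fun n => ?_) (tendsto_atTop_add_const_right atTop (-C) h)
        have := hC (x.1 n) (y.1 n) (w.1 n) z
        linarith }

/-- The Gromov boundary `∂X`: Gromov sequences modulo equivalence. -/
def Boundary (X : Type*) [MetricSpace X] [HyperbolicSpace X] : Type _ :=
  Quotient (gromovSetoid X)

section Boundary

variable {X : Type*} [MetricSpace X] [HyperbolicSpace X]

/-- The class in `∂X` of a Gromov sequence. -/
def GromovSeq.toBoundary (x : GromovSeq X) : Boundary X := Quotient.mk (gromovSetoid X) x

/-- The Gromov product `⟨ξ|η⟩_z` of two boundary points, with values in the extended reals: it is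
`+∞` when `ξ = η`. -/
def bdryProd (z : X) (ξ η : Boundary X) : EReal :=
  ⨅ (x : GromovSeq X) (y : GromovSeq X) (_ : x.toBoundary = ξ) (_ : y.toBoundary = η),
    liminf (fun p : ℕ × ℕ => ((gromovProd z (x.1 p.1) (y.1 p.2) : ℝ) : EReal)) atTop

/-- The Gromov product `⟨ξ|y⟩_z = ⟨y|ξ⟩_z` of a boundary point and a point. The infimum is taken in
the extended reals; it lies in `[0, dist y z]`. -/
def mixedProd (z : X) (ξ : Boundary X) (y : X) : ℝ :=
  (⨅ (x : GromovSeq X) (_ : x.toBoundary = ξ),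
    liminf (fun n : ℕ => ((gromovProd z (x.1 n) y : ℝ) : EReal)) atTop).toReal

/-- The Busemann function `B_ξ(y, z) = ⟨z|ξ⟩_y - ⟨y|ξ⟩_z` of a boundary point. -/
def busemann (ξ : Boundary X) (y z : X) : ℝ := mixedProd y ξ z - mixedProd z ξ y

/-- The topology of `∂X`, as a subspace of `X ∪ ∂X`: a set `U` is open if for each `ξ ∈ U` it
contains some `N_t(ξ) = {η | ⟨η|ξ⟩_o > t}`. Replacing `o` by another base point changes the products
by a bounded amount, so that one `o` would do. -/
instance : TopologicalSpace (Boundary X) where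
  IsOpen U := ∀ o : X, ∀ ξ ∈ U, ∃ t : ℝ, 0 < t ∧ ∀ η, (t : EReal) < bdryProd o η ξ → η ∈ U
  isOpen_univ := fun _ _ _ => ⟨1, one_pos, fun _ _ => trivial⟩
  isOpen_inter := by
    intro U V hU hV o ξ hξ
    obtain ⟨s, hs, hsU⟩ := hU o ξ hξ.1
    obtain ⟨t, _, htV⟩ := hV o ξ hξ.2
    refine ⟨max s t, lt_max_of_lt_left hs, fun η hη => ⟨hsU η ?_, htV η ?_⟩⟩
    · exact lt_of_le_of_lt (EReal.coe_le_coe_iff.2 (le_max_left s t)) hη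
    · exact lt_of_le_of_lt (EReal.coe_le_coe_iff.2 (le_max_right s t)) hη
  isOpen_sUnion := by
    intro S hS o ξ hξ
    obtain ⟨U, hU, hξU⟩ := hξ
    obtain ⟨t, ht, htU⟩ := hS U hU o ξ hξU
    exact ⟨t, ht, fun η hη => ⟨U, hU, htU η hη⟩⟩

instance : MeasurableSpace (Boundary X) := borel (Boundary X)

instance : BorelSpace (Boundary X) := ⟨rfl⟩

/-- The action of an isometry on Gromov sequences. -/
def GromovSeq.map (g : X ≃ᵢ X) (x : GromovSeq X) : GromovSeq X :=
  ⟨fun n => g (x.1 n), fun z => by simpa only [gromovProd_isometry] using x.2 (g⁻¹ z)⟩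

/-- The action of an isometry on `∂X`. -/
def bdryMap (g : X ≃ᵢ X) : Boundary X → Boundary X :=
  Quotient.map' (GromovSeq.map g) fun x y h z => by
    simpa only [GromovSeq.map, gromovProd_isometry] using h (g⁻¹ z)

/-- `D` is a visual metric on `∂X` with parameter `b` and base point `o`: a metric comparable to
`b ^ (-⟨ξ|η⟩_o)`. (For `ξ = η` both sides of the comparison are `0`.) -/
structure IsVisualMetric (b : ℝ) (o : X) (D : Boundary X → Boundary X → ℝ) : Prop where
  self : ∀ ξ, D ξ ξ = 0
  eq_of_eq_zero : ∀ ξ η, D ξ η = 0 → ξ = η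
  symm : ∀ ξ η, D ξ η = D η ξ
  triangle : ∀ ξ η ζ, D ξ ζ ≤ D ξ η + D η ζ
  comparable : ∃ C : ℝ, 0 < C ∧ ∀ ξ η, ξ ≠ η →
    C⁻¹ * b ^ (-(bdryProd o ξ η).toReal) ≤ D ξ η ∧ D ξ η ≤ C * b ^ (-(bdryProd o ξ η).toReal)

/-! ## Groups of isometries -/

/-- Strong discreteness of a group of isometries. -/
def IsStronglyDiscrete (o : X) (G : Subgroup (X ≃ᵢ X)) : Prop :=
  ∀ r : ℝ, 0 < r → {g : X ≃ᵢ X | g ∈ G ∧ dist o (g o) ≤ r}.Finite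

/-- The positive iterates of `g` converge to `p` uniformly on the complement of every neighbourhood
of `q`. (Uniform convergence to the constant `p`: for every neighbourhood `V` of `p`, the complement
is eventually mapped into `V`.) -/
def AttractsTo (g : X ≃ᵢ X) (p q : Boundary X) : Prop :=
  ∀ U ∈ 𝓝 q, ∀ V ∈ 𝓝 p, ∀ᶠ n : ℕ in atTop, ∀ ξ ∉ U, bdryMap (g ^ n) ξ ∈ V

/-- A loxodromic isometry: it has two fixed points on the boundary, one attracting and the other
one repelling. -/
def IsLoxodromic (g : X ≃ᵢ X) : Prop :=
  ∃ p q : Boundary X, p ≠ q ∧ bdryMap g p = p ∧ bdryMap g q = q ∧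
    AttractsTo g p q ∧ AttractsTo g⁻¹ q p

/-- A group of general type: it contains two loxodromic isometries without common fixed points on
the boundary. -/
def IsGeneralType (G : Subgroup (X ≃ᵢ X)) : Prop :=
  ∃ g₁ ∈ G, ∃ g₂ ∈ G, IsLoxodromic g₁ ∧ IsLoxodromic g₂ ∧
    ∀ ξ : Boundary X, ¬ (bdryMap g₁ ξ = ξ ∧ bdryMap g₂ ξ = ξ)

/-- The sequence `x` of points of `X` converges to the boundary point `ξ`: `⟨x n|ξ⟩_o → ∞`. -/
def ConvergesTo (o : X) (x : ℕ → X) (ξ : Boundary X) : Prop :=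
  Tendsto (fun n => mixedProd o ξ (x n)) atTop atTop

/-- The shadow `{η | ⟨z|η⟩_x ≤ σ}` cast by `x` from the light source `z`. -/
def shadow (z x : X) (σ : ℝ) : Set (Boundary X) := {η | mixedProd x η z ≤ σ}

/-- `x` converges to `ξ` `σ`-uniformly radially. The sequence starts at index `0`. -/
def ConvergesUniformlyRadially (o : X) (σ : ℝ) (x : ℕ → X) (ξ : Boundary X) : Prop :=
  ConvergesTo o x ξ ∧ (∀ n, ξ ∈ shadow o (x n) σ) ∧ (∀ n, dist (x n) (x (n + 1)) ≤ σ) ∧ x 0 = o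

/-- The limit set `Λ` of `G`. -/
def limitSet (o : X) (G : Subgroup (X ≃ᵢ X)) : Set (Boundary X) :=
  {η | ∃ g : ℕ → X ≃ᵢ X, (∀ n, g n ∈ G) ∧ ConvergesTo o (fun n => g n o) η}

/-- The uniformly radial limit set `Λ_ur` of `G`. -/
def uniformlyRadialLimitSet (o : X) (G : Subgroup (X ≃ᵢ X)) : Set (Boundary X) :=
  {η | ∃ g : ℕ → X ≃ᵢ X, (∀ n, g n ∈ G) ∧
    ∃ σ : ℝ, 0 < σ ∧ ConvergesUniformlyRadially o σ (fun n => g n o) η}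

/-- The Poincaré series `∑ b ^ (-s * dist o (g o))` over the elements of `G`. -/
def poincareSeries (b : ℝ) (o : X) (G : Subgroup (X ≃ᵢ X)) (s : ℝ) : ℝ≥0∞ :=
  ∑' g : G, ENNReal.ofReal (b ^ (-s * dist o ((g : X ≃ᵢ X) o)))

/-- The Poincaré exponent of `G` relative to `b`; it is `∞` if the Poincaré series diverges for
all `s`. -/
def poincareExponent (b : ℝ) (o : X) (G : Subgroup (X ≃ᵢ X)) : ℝ≥0∞ :=
  ⨅ (s : ℝ≥0) (_ : poincareSeries b o G s < ∞), (s : ℝ≥0∞)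

/-- `G` is quasiconvex-cocompact: every geodesic segment joining two points of the orbit of `o`
stays within a uniformly bounded distance of that orbit. -/
def IsQuasiconvexCocompact (o : X) (G : Subgroup (X ≃ᵢ X)) : Prop :=
  ∃ ρ : ℝ, 0 < ρ ∧ ∀ g ∈ G, ∀ h ∈ G, ∀ S : Set X, IsGeodesicSegment (g o) (h o) S →
    S ⊆ ⋃ k ∈ G, Metric.closedBall (k o) ρ

/-- The coarse derivative `g'(ξ) = b ^ (B_ξ(o, g⁻¹ o))`. -/
def isometryDeriv (b : ℝ) (o : X) (g : X ≃ᵢ X) (ξ : Boundary X) : ℝ := b ^ busemann ξ o (g⁻¹ o)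

/-- `μ` is `s`-quasiconformal with respect to `G`: up to a constant that depends neither on `g` nor
on `A`, `μ(g(A))` is the integral over `A` of the `s`-th power of `g'`. -/
def IsQuasiconformal (b : ℝ) (o : X) (G : Subgroup (X ≃ᵢ X)) (s : ℝ)
    (μ : Measure (Boundary X)) : Prop :=
  ∃ C : ℝ≥0, ∀ g ∈ G, ∀ A : Set (Boundary X), MeasurableSet A →
    μ (bdryMap g '' A) ≤ C * ∫⁻ ξ in A, ENNReal.ofReal (isometryDeriv b o g ξ ^ s) ∂μ ∧
    ∫⁻ ξ in A, ENNReal.ofReal (isometryDeriv b o g ξ ^ s) ∂μ ≤ C * μ (bdryMap g '' A)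

end Boundary

end

end Gromov

/-! If `G` is quasiconvex-cocompact, the geodesic segments from `o` to orbit points tending to a
limit point are followed by orbit points at bounded distance. A limit of these chains is a uniformly
radial sequence, so every limit point is uniformly radial
(`IsQuasiconvexCocompact.limitSet_subset`). If these points formed a null set, `μ` would vanish.

Conversely, suppose that `G` is not quasiconvex-cocompact. Some segment between orbit points then
has a point far from the orbit. Translating it by `G`, and turning it if necessary with one of two
isometries that have no common fixed point on the boundary, puts such a gap behind every orbit point
at a bounded distance (`exists_holes`). Fix `σ`. A sequence converging `σ`-uniformly radially forces
every point between `o` and its members to be near the orbit. Hence the shadow of an orbit point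
contains a hole, namely a shadow cast beyond the gap, which meets no later shadow of such a
sequence.

By Sullivan's shadow lemma the hole has measure comparable to that of the shadow around it, and
strong discreteness bounds the overlaps of holes at one level. The `σ`-uniformly radial points are
covered by the shadows of each level, so their measure is at most a constant times that of the union
of the holes of the level. These unions are disjoint for different levels and `μ` is finite, so
their measures tend to zero (`measure_eq_zero_of_holes`). A countable union over `σ` finishes the
proof.

The shadow lemma needs only that `G` fixes no boundary point: a quasiconformal measure is then not
carried by one point, and by a Borel–Cantelli argument it cannot concentrate in one direction. -/

namespace Gromov

/-! ### Gromov products of points -/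

section Points

variable {X : Type*} [MetricSpace X]

/-- `C` is an admissible additive constant in Gromov's inequality. -/
def IsHyperbolicConst (X : Type*) [MetricSpace X] (C : ℝ) : Prop :=
  0 ≤ C ∧ ∀ x y z w : X, min (gromovProd w x y) (gromovProd w y z) - C ≤ gromovProd w x z

lemma exists_isHyperbolicConst (X : Type*) [MetricSpace X] [HyperbolicSpace X] :
    ∃ C : ℝ, IsHyperbolicConst X C := by
  obtain ⟨C, hC⟩ := HyperbolicSpace.exists_const (X := X)
  refine ⟨max C 0, le_max_right _ _, fun x y z w => ?_⟩
  linarith [hC x y z w, le_max_left C 0]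

lemma gromovProd_comm (z x y : X) : gromovProd z x y = gromovProd z y x := by
  unfold gromovProd
  rw [dist_comm x y]
  ring

lemma gromovProd_nonneg (z x y : X) : 0 ≤ gromovProd z x y := by
  unfold gromovProd
  linarith [dist_triangle_right x y z]

lemma gromovProd_le_dist_right (z x y : X) : gromovProd z x y ≤ dist y z := by
  unfold gromovProd
  linarith [dist_triangle x y z]

/-- Gromov's inequality in disjunctive form. -/
lemma IsHyperbolicConst.le_or_le {C : ℝ} (hC : IsHyperbolicConst X C) (w x y z : X) :
    gromovProd w x y - C ≤ gromovProd w x z ∨ gromovProd w y z - C ≤ gromovProd w x z := by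
  have h := hC.2 x y z w
  rcases min_choice (gromovProd w x y) (gromovProd w y z) with e | e <;> rw [e] at h
  · exact Or.inl h
  · exact Or.inr h

lemma IsHyperbolicConst.le_of_le {C a : ℝ} (hC : IsHyperbolicConst X C) {w x y z : X}
    (h₁ : a ≤ gromovProd w x y) (h₂ : a ≤ gromovProd w y z) : a - C ≤ gromovProd w x z := by
  rcases hC.le_or_le w x y z with h | h <;> linarith

/-- Every point of a geodesic segment lies between its endpoints. -/
lemma IsGeodesicSegment.dist_add_dist {x y p : X} {S : Set X} (hS : IsGeodesicSegment x y S)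
    (hp : p ∈ S) : dist x p + dist p y = dist x y := by
  obtain ⟨γ, h0, h1, hiso, rfl⟩ := hS
  obtain ⟨t, ht, rfl⟩ := hp
  have a := hiso 0 ⟨le_rfl, dist_nonneg⟩ t ht
  have c := hiso t ht (dist x y) ⟨dist_nonneg, le_rfl⟩
  rw [h0, zero_sub, abs_neg, abs_of_nonneg ht.1] at a
  rw [h1, abs_of_nonpos (by linarith [ht.2])] at c
  linarith

/-- A geodesic segment has a point at every prescribed distance from its initial point. -/
lemma IsGeodesicSegment.exists_dist_eq {x y : X} {S : Set X} (hS : IsGeodesicSegment x y S)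
    {t : ℝ} (ht0 : 0 ≤ t) (ht : t ≤ dist x y) : ∃ p ∈ S, dist x p = t := by
  obtain ⟨γ, h0, h1, hiso, rfl⟩ := hS
  refine ⟨γ t, mem_image_of_mem γ ⟨ht0, ht⟩, ?_⟩
  have a := hiso 0 ⟨le_rfl, dist_nonneg⟩ t ⟨ht0, ht⟩
  rwa [h0, zero_sub, abs_neg, abs_of_nonneg ht0] at a

lemma IsGeodesicSegment.dist_eq_abs {x y p q : X} {S : Set X} (hS : IsGeodesicSegment x y S)
    (hp : p ∈ S) (hq : q ∈ S) : dist p q = |dist x p - dist x q| := by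
  obtain ⟨γ, h0, h1, hiso, rfl⟩ := hS
  have a : ∀ t ∈ Icc 0 (dist x y), dist x (γ t) = t := fun t ht => by
    have := hiso 0 ⟨le_rfl, dist_nonneg⟩ t ht
    rwa [h0, zero_sub, abs_neg, abs_of_nonneg ht.1] at this
  obtain ⟨s, hs, rfl⟩ := hp
  obtain ⟨t, ht, rfl⟩ := hq
  rw [hiso s hs t ht, a s hs, a t ht]

/-- In a proper geodesic space a sequence going to infinity has a subsequence that is a Gromov
sequence. -/
lemma exists_isGromovSeq_comp [ProperSpace X] (hgeod : IsGeodesicSpace X) (o : X) (y : ℕ → X)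
    (hy : Tendsto (fun n => dist o (y n)) atTop atTop) :
    ∃ φ : ℕ → ℕ, (∀ k, k ≤ φ k) ∧ IsGromovSeq (fun k => y (φ k)) := by
  have hP : ∀ n k : ℕ, ∃ p : X, dist o p = min (k : ℝ) (dist o (y n)) ∧
      dist o p + dist p (y n) = dist o (y n) := fun n k => by
    obtain ⟨S, hS⟩ := hgeod o (y n)
    obtain ⟨p, hpS, hp⟩ := hS.exists_dist_eq (t := min (k : ℝ) (dist o (y n)))
      (le_min (Nat.cast_nonneg k) dist_nonneg) (min_le_right _ _)
    exact ⟨p, hp, hS.dist_add_dist hpS⟩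
  choose P hP1 hP2 using hP
  -- Closed balls are compact, so `P n k` converges for every `k` along one and the same
  -- nonprincipal ultrafilter; this replaces a diagonal extraction.
  have hlim : ∀ k : ℕ, ∃ q : X, ∀ᶠ n in (hyperfilter ℕ : Filter ℕ), dist (P n k) q < 1 := fun k => by
    have hmem : ∀ n, P n k ∈ Metric.closedBall o k := fun n => by
      rw [Metric.mem_closedBall, dist_comm, hP1]
      exact min_le_left _ _
    obtain ⟨q, -, hq⟩ := (isCompact_closedBall o (k : ℝ)).ultrafilter_le_nhds
      ((hyperfilter ℕ).map fun n => P n k) (by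
        rw [le_principal_iff]
        exact Filter.mem_map.2 (univ_mem' hmem))
    exact ⟨q, hq (Metric.ball_mem_nhds q one_pos)⟩
  choose q hq using hlim
  have hfar : ∀ k : ℕ, ∀ᶠ n in (hyperfilter ℕ : Filter ℕ), (k : ℝ) ≤ dist o (y n) := fun k =>
    Nat.hyperfilter_le_atTop (hy.eventually_ge_atTop (k : ℝ))
  have hφ : ∀ k : ℕ, ∃ n, k ≤ n ∧ ∀ j ≤ k, dist (P n j) (q j) < 1 ∧ (j : ℝ) ≤ dist o (y n) :=
      fun k => by
    have h1 : ∀ᶠ n in (hyperfilter ℕ : Filter ℕ), ∀ j ∈ Finset.range (k + 1),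
        dist (P n j) (q j) < 1 ∧ (j : ℝ) ≤ dist o (y n) :=
      (Filter.eventually_all_finset _).2 fun j _ => (hq j).and (hfar j)
    obtain ⟨n, hn, hkn⟩ := (h1.and (Nat.hyperfilter_le_atTop (eventually_ge_atTop k))).exists
    exact ⟨n, hkn, fun j hj => hn j (Finset.mem_range.2 (Nat.lt_succ_of_le hj))⟩
  choose φ hφ1 hφ2 using hφ
  refine ⟨φ, hφ1, (isGromovSeq_iff o _).2 (tendsto_atTop.2 fun r => ?_)⟩
  -- Segments to two late terms both pass within 1 of `q j` at distance `j` from `o`, so the Gromov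
  -- product of these terms is at least `j - 1`.
  obtain ⟨j, hj⟩ := exists_nat_ge (r + 1)
  filter_upwards [eventually_ge_atTop (j, j)] with p hp
  obtain ⟨a1, a2⟩ := hφ2 p.1 j hp.1
  obtain ⟨b1, b2⟩ := hφ2 p.2 j hp.2
  have e1 := hP1 (φ p.1) j
  have e2 := hP1 (φ p.2) j
  rw [min_eq_left a2] at e1
  rw [min_eq_left b2] at e2
  have f1 := hP2 (φ p.1) j
  have f2 := hP2 (φ p.2) j
  have t1 := dist_triangle4 (y (φ p.1)) (P (φ p.1) j) (P (φ p.2) j) (y (φ p.2))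
  have t2 := dist_triangle_right (P (φ p.1) j) (P (φ p.2) j) (q j)
  unfold gromovProd
  rw [dist_comm _ o, dist_comm _ o]
  rw [dist_comm (y (φ p.1)) (P (φ p.1) j)] at t1
  linarith

lemma gromovProd_eq_dist {o p x : X} (h : dist o p + dist p x = dist o x) :
    gromovProd o p x = dist o p := by
  unfold gromovProd
  rw [dist_comm p o, dist_comm x o]
  linarith

/-- A sequence that starts at `o` with steps of length at most `σ` visits every annulus of width
`σ` that it crosses. -/
lemma exists_dist_mem_Icc {o : X} {a : ℕ → X} {σ t : ℝ} (h0 : a 0 = o) (ht : 0 ≤ t) (hσ : 0 ≤ σ)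
    (hstep : ∀ n, dist (a n) (a (n + 1)) ≤ σ) {n : ℕ} (hn : t ≤ dist o (a n)) :
    ∃ i, t ≤ dist o (a i) ∧ dist o (a i) ≤ t + σ := by
  classical
  have hex : ∃ i, t ≤ dist o (a i) := ⟨n, hn⟩
  refine ⟨Nat.find hex, Nat.find_spec hex, ?_⟩
  rcases Nat.eq_zero_or_eq_succ_pred (Nat.find hex) with h | h
  · rw [h, h0, dist_self]
    positivity
  · have hlt := not_le.1 (Nat.find_min hex (Nat.pred_lt_self (by omega)))
    rw [h]
    linarith [dist_triangle o (a (Nat.find hex).pred) (a (Nat.find hex).pred.succ),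
      hstep (Nat.find hex).pred]

end Points

/-! ### Gromov products with a boundary point -/

section Mixed

variable {X : Type*} [MetricSpace X] [HyperbolicSpace X]

lemma toBoundary_eq_iff {x y : GromovSeq X} : x.toBoundary = y.toBoundary ↔ GromovSeq.Equiv x y :=
  Quotient.eq (r := gromovSetoid X)

lemma exists_toBoundary_eq (ξ : Boundary X) : ∃ x : GromovSeq X, x.toBoundary = ξ :=
  Quotient.exists_rep ξ

/-- Gromov's inequality through the intermediate point `x n` passes from the diagonal to two
independent indices. -/
lemma GromovSeq.Equiv.tendsto_prod {x y : GromovSeq X} (h : GromovSeq.Equiv x y) (z : X) :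
    Tendsto (fun p : ℕ × ℕ => gromovProd z (x.1 p.1) (y.1 p.2)) atTop atTop := by
  obtain ⟨C, hC⟩ := exists_isHyperbolicConst X
  have h2 : Tendsto (fun p : ℕ × ℕ => gromovProd z (x.1 p.2) (y.1 p.2)) atTop atTop :=
    (h z).comp (by rw [← prod_atTop_atTop_eq]; exact tendsto_snd)
  refine tendsto_atTop.2 fun r => ?_
  filter_upwards [(tendsto_atTop.1 (x.2 z)) (r + C), (tendsto_atTop.1 h2) (r + C)] with p a b
  linarith [hC.le_of_le a b]

/-- The infimum lies between `0` and `dist y z`, so `toReal` loses nothing. -/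
lemma coe_mixedProd (z : X) (ξ : Boundary X) (y : X) : ((mixedProd z ξ y : ℝ) : EReal) =
    ⨅ (x : GromovSeq X) (_ : x.toBoundary = ξ),
      liminf (fun n : ℕ => ((gromovProd z (x.1 n) y : ℝ) : EReal)) atTop := by
  refine EReal.coe_toReal (ne_top_of_le_ne_top (EReal.coe_ne_top (dist y z)) ?_)
    (ne_bot_of_le_ne_bot EReal.zero_ne_bot ?_)
  · obtain ⟨x, hx⟩ := exists_toBoundary_eq ξ
    refine (iInf₂_le x hx).trans ((liminf_le_liminf (Eventually.of_forall fun n =>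
      EReal.coe_le_coe_iff.2 (gromovProd_le_dist_right z (x.1 n) y))).trans ?_)
    rw [liminf_const]
  · refine le_iInf₂ fun x _ => le_trans ?_ (liminf_le_liminf (Eventually.of_forall fun n =>
      EReal.coe_nonneg.2 (gromovProd_nonneg z (x.1 n) y)))
    rw [liminf_const]

/-- Gromov products along any sequence representing `ξ` are eventually not much smaller than the
product with `ξ`. -/
lemma eventually_mixedProd_sub_lt {ξ : Boundary X} {x : GromovSeq X} (hx : x.toBoundary = ξ)
    (z y : X) {ε : ℝ} (hε : 0 < ε) : ∀ᶠ n in atTop, mixedProd z ξ y - ε < gromovProd z (x.1 n) y := by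
  have h : ((mixedProd z ξ y - ε : ℝ) : EReal) <
      liminf (fun n : ℕ => ((gromovProd z (x.1 n) y : ℝ) : EReal)) atTop := by
    refine lt_of_lt_of_le (EReal.coe_lt_coe_iff.2 (sub_lt_self _ hε)) ?_
    rw [coe_mixedProd]
    exact iInf₂_le x hx
  filter_upwards [eventually_lt_of_lt_liminf h] with n hn
  exact EReal.coe_lt_coe_iff.1 hn

lemma exists_frequently_lt_mixedProd_add (ξ : Boundary X) (z y : X) {ε : ℝ} (hε : 0 < ε) :
    ∃ x : GromovSeq X, x.toBoundary = ξ ∧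
      ∃ᶠ n in atTop, gromovProd z (x.1 n) y < mixedProd z ξ y + ε := by
  have h : ((mixedProd z ξ y : ℝ) : EReal) < ((mixedProd z ξ y + ε : ℝ) : EReal) :=
    EReal.coe_lt_coe_iff.2 (lt_add_of_pos_right _ hε)
  nth_rewrite 1 [coe_mixedProd] at h
  obtain ⟨x, hx⟩ := iInf_lt_iff.1 h
  obtain ⟨hxξ, hx⟩ := iInf_lt_iff.1 hx
  exact ⟨x, hxξ, (frequently_lt_of_liminf_lt (by isBoundedDefault) hx).mono fun n hn =>
    EReal.coe_lt_coe_iff.1 hn⟩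

/-- The Gromov product with a boundary point is, up to an additive constant, the Gromov product with
any point far out in a sequence representing it. -/
lemma IsHyperbolicConst.eventually_abs_sub_le {C : ℝ} (hC : IsHyperbolicConst X C) {ξ : Boundary X}
    {x : GromovSeq X} (hx : x.toBoundary = ξ) (z y : X) :
    ∀ᶠ n in atTop, |gromovProd z (x.1 n) y - mixedProd z ξ y| ≤ C + 1 := by
  obtain ⟨x', hx', hfr⟩ := exists_frequently_lt_mixedProd_add ξ z y one_pos
  have hprod := (toBoundary_eq_iff.1 (hx'.trans hx.symm)).tendsto_prod z
  rw [← prod_atTop_atTop_eq] at hprod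
  have hev := (hprod.eventually_ge_atTop (dist y z + C + 1)).curry
  obtain ⟨m, hm1, hm2⟩ := (hfr.and_eventually hev).exists
  filter_upwards [hm2, eventually_mixedProd_sub_lt hx z y one_pos] with n hn1 hn2
  have h0 := hC.1
  rw [abs_le]
  refine ⟨by linarith, ?_⟩
  have hle := gromovProd_le_dist_right z (x.1 n) y
  -- The first alternative is impossible: the product of `x' m` and `x n` was chosen larger than
  -- `dist y z + C`.
  rcases hC.le_or_le z (x'.1 m) (x.1 n) y with h | h
  · linarith [gromovProd_le_dist_right z (x'.1 m) y]
  · linarith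

end Mixed

/-! ### Coarse geometry of boundary points and shadows -/

section Boundary

variable {X : Type*} [MetricSpace X] [HyperbolicSpace X]

/-- For three points the two products add up to the distance exactly; each costs `C + 1` when one of
the points goes to the boundary. -/
lemma IsHyperbolicConst.abs_mixedProd_add_sub_dist_le {C : ℝ} (hC : IsHyperbolicConst X C)
    (ξ : Boundary X) (z y : X) : |mixedProd z ξ y + mixedProd y ξ z - dist z y| ≤ 2 * (C + 1) := by
  obtain ⟨x, hx⟩ := exists_toBoundary_eq ξ
  obtain ⟨n, h1, h2⟩ :=
    ((hC.eventually_abs_sub_le hx z y).and (hC.eventually_abs_sub_le hx y z)).exists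
  rw [abs_le] at *
  have e : gromovProd z (x.1 n) y + gromovProd y (x.1 n) z = dist z y := by
    unfold gromovProd
    rw [dist_comm y z]
    ring
  constructor <;> linarith [h1.1, h1.2, h2.1, h2.2]

lemma mixedProd_nonneg (z : X) (ξ : Boundary X) (y : X) : 0 ≤ mixedProd z ξ y := by
  rw [← EReal.coe_nonneg, coe_mixedProd]
  refine le_iInf₂ fun x _ => le_trans ?_ (liminf_le_liminf (Eventually.of_forall fun n =>
    EReal.coe_nonneg.2 (gromovProd_nonneg z (x.1 n) y)))
  rw [liminf_const]

lemma mixedProd_le_dist (z : X) (ξ : Boundary X) (y : X) : mixedProd z ξ y ≤ dist y z := by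
  refine le_of_forall_pos_lt_add fun ε hε => ?_
  obtain ⟨x, hx⟩ := exists_toBoundary_eq ξ
  obtain ⟨n, hn⟩ := (eventually_mixedProd_sub_lt hx z y hε).exists
  linarith [gromovProd_le_dist_right z (x.1 n) y]

/-- Gromov's inequality for two points and a boundary point. -/
lemma IsHyperbolicConst.le_gromovProd_of_le_mixedProd {C a : ℝ} (hC : IsHyperbolicConst X C)
    {ξ : Boundary X} {w x y : X} (hx : a ≤ mixedProd w ξ x) (hy : a ≤ mixedProd w ξ y) :
    a - (2 * C + 1) ≤ gromovProd w x y := by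
  obtain ⟨u, hu⟩ := exists_toBoundary_eq ξ
  obtain ⟨n, h1, h2⟩ :=
    ((hC.eventually_abs_sub_le hu w x).and (hC.eventually_abs_sub_le hu w y)).exists
  rw [abs_le] at h1 h2
  have h := hC.le_of_le (a := a - (C + 1)) (w := w) (x := x) (y := u.1 n) (z := y)
    (by rw [gromovProd_comm]; linarith [h1.1]) (by linarith [h2.1])
  linarith

/-- A sequence converging to a boundary point is a Gromov sequence that represents it. -/
lemma ConvergesTo.exists_gromovSeq {o : X} {x : ℕ → X} {ξ : Boundary X} (h : ConvergesTo o x ξ) :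
    ∃ u : GromovSeq X, u.1 = x ∧ u.toBoundary = ξ := by
  obtain ⟨C, hC⟩ := exists_isHyperbolicConst X
  have hG : IsGromovSeq x := by
    refine (isGromovSeq_iff o x).2 (tendsto_atTop.2 fun r => ?_)
    have hr := h.eventually_ge_atTop (r + (2 * C + 1))
    rw [← prod_atTop_atTop_eq]
    filter_upwards [hr.prod_mk hr] with p hp
    linarith [hC.le_gromovProd_of_le_mixedProd hp.1 hp.2]
  refine ⟨⟨x, hG⟩, rfl, ?_⟩
  obtain ⟨y, hy⟩ := exists_toBoundary_eq ξ
  refine (toBoundary_eq_iff.2 fun z => ?_).trans hy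
  refine tendsto_gromovProd_base (o := o) (tendsto_atTop.2 fun r => ?_) z
  have hy2 := y.2 o
  rw [← prod_atTop_atTop_eq] at hy2
  filter_upwards [(hy2.eventually_ge_atTop (r + C)).curry, h.eventually_ge_atTop (r + C + (C + 1))] with n hn1 hn2
  obtain ⟨k, hk1, hk2⟩ := (hn1.and (hC.eventually_abs_sub_le hy o (x n))).exists
  rw [abs_le] at hk2
  have := hC.le_of_le (a := r + C) (w := o) (x := x n) (y := y.1 k) (z := y.1 n)
    (by rw [gromovProd_comm]; linarith [hk2.1]) (by rw [gromovProd_comm]; exact hk1)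
  simpa using this

/-- Two boundary points with unbounded Gromov products with the same points coincide. -/
lemma eq_of_tendsto_mixedProd {o : X} {y : ℕ → X} {ξ η : Boundary X} (hξ : ConvergesTo o y ξ)
    (hη : ConvergesTo o y η) : ξ = η := by
  obtain ⟨u, hu, rfl⟩ := hξ.exists_gromovSeq
  obtain ⟨v, hv, rfl⟩ := hη.exists_gromovSeq
  rw [Subtype.ext (hu.trans hv.symm)]

/-- Shadows are closed. -/
lemma isClosed_shadow (z x : X) (σ : ℝ) : IsClosed (shadow z x σ) := by
  obtain ⟨C, hC⟩ := exists_isHyperbolicConst X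
  rw [← isOpen_compl_iff]
  intro o ξ hξ
  by_contra hcon
  push Not at hcon
  have hη : ∀ n : ℕ, ∃ η : Boundary X, ((n + 1 : ℝ) : EReal) < bdryProd o η ξ ∧
      mixedProd x η z ≤ σ := fun n => by
    obtain ⟨η, h1, h2⟩ := hcon (n + 1) (by positivity)
    exact ⟨η, h1, not_not.1 h2⟩
  choose η hη1 hη2 using hη
  obtain ⟨u, hu⟩ := exists_toBoundary_eq ξ
  -- A diagonal choice: `w n` is taken from a sequence representing `η n`, far enough out that `w`
  -- converges to `ξ`. As `mixedProd` is an infimum over all representing sequences, the bound `σ`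
  -- survives in the limit without an additive error.
  have hw : ∀ n : ℕ, ∃ w : X, gromovProd x w z < σ + 1 / (n + 1 : ℝ) ∧
      (n : ℝ) - (C + 1) ≤ mixedProd o ξ w := fun n => by
    obtain ⟨v, hv, hfr⟩ := exists_frequently_lt_mixedProd_add (η n) x z
      (Nat.one_div_pos_of_nat (α := ℝ) (n := n))
    have hlim : ((n + 1 : ℝ) : EReal) <
        liminf (fun p : ℕ × ℕ => ((gromovProd o (v.1 p.1) (u.1 p.2) : ℝ) : EReal)) atTop :=
      (hη1 n).trans_le (iInf₂_le_of_le v u (iInf₂_le hv hu))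
    have hev := eventually_lt_of_lt_liminf hlim
    rw [← prod_atTop_atTop_eq] at hev
    obtain ⟨m, hm1, hm2⟩ := (hfr.and_eventually hev.curry).exists
    obtain ⟨k, hk1, hk2⟩ := (hm2.and (hC.eventually_abs_sub_le hu o (v.1 m))).exists
    refine ⟨v.1 m, by linarith [hη2 n], ?_⟩
    have hk1' := EReal.coe_lt_coe_iff.1 hk1
    rw [gromovProd_comm] at hk1'
    rw [abs_le] at hk2
    linarith [hk2.2]
  choose w hw1 hw2 using hw
  have hconv : ConvergesTo o w ξ := tendsto_atTop_mono hw2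
    (tendsto_atTop_add_const_right _ _ tendsto_natCast_atTop_atTop)
  obtain ⟨W, hW, hWξ⟩ := hconv.exists_gromovSeq
  have hpos : 0 < mixedProd x ξ z - σ := sub_pos.2 (not_le.1 hξ)
  have hsmall : ∀ᶠ n : ℕ in atTop, 1 / (n + 1 : ℝ) < (mixedProd x ξ z - σ) / 2 :=
    (tendsto_one_div_add_atTop_nhds_zero_nat (𝕜 := ℝ)).eventually_lt_const (half_pos hpos)
  obtain ⟨n, hn1, hn2⟩ := (hsmall.and (eventually_mixedProd_sub_lt hWξ x z (half_pos hpos))).exists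
  rw [hW] at hn2
  linarith [hw1 n]

lemma measurableSet_shadow (z x : X) (σ : ℝ) : MeasurableSet (shadow z x σ) :=
  (isClosed_shadow z x σ).measurableSet

/-! ### The action of isometries -/

lemma bdryMap_toBoundary (g : X ≃ᵢ X) (x : GromovSeq X) :
    bdryMap g x.toBoundary = (x.map g).toBoundary := rfl

lemma bdryMap_inv_bdryMap (g : X ≃ᵢ X) (ξ : Boundary X) : bdryMap g⁻¹ (bdryMap g ξ) = ξ := by
  obtain ⟨x, rfl⟩ := exists_toBoundary_eq ξ
  rw [bdryMap_toBoundary, bdryMap_toBoundary]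
  congr 1
  exact Subtype.ext (funext fun n => IsometryEquiv.inv_apply_self g (x.1 n))

lemma bdryMap_bdryMap_inv (g : X ≃ᵢ X) (ξ : Boundary X) : bdryMap g (bdryMap g⁻¹ ξ) = ξ := by
  simpa using bdryMap_inv_bdryMap g⁻¹ ξ

lemma mixedProd_bdryMap (g : X ≃ᵢ X) (z : X) (ξ : Boundary X) (y : X) :
    mixedProd (g z) (bdryMap g ξ) (g y) = mixedProd z ξ y := by
  have key : ∀ (g : X ≃ᵢ X) (z : X) (ξ : Boundary X) (y : X),
      mixedProd (g z) (bdryMap g ξ) (g y) ≤ mixedProd z ξ y := by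
    intro g z ξ y
    rw [← EReal.coe_le_coe_iff, coe_mixedProd, coe_mixedProd]
    refine le_iInf₂ fun x hx => (iInf₂_le (x.map g) (by rw [← bdryMap_toBoundary, hx])).trans ?_
    simp only [GromovSeq.map, gromovProd_isometry, IsometryEquiv.inv_apply_self]
    rfl
  refine le_antisymm (key g z ξ y) ?_
  have := key g⁻¹ (g z) (bdryMap g ξ) (g y)
  rwa [bdryMap_inv_bdryMap, IsometryEquiv.inv_apply_self, IsometryEquiv.inv_apply_self] at this

lemma bdryMap_image_shadow (g : X ≃ᵢ X) (z x : X) (σ : ℝ) :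
    bdryMap g '' shadow z x σ = shadow (g z) (g x) σ := by
  ext η
  constructor
  · rintro ⟨ξ, hξ, rfl⟩
    simpa only [shadow, mem_ofPred_eq, mixedProd_bdryMap] using hξ
  · intro hη
    refine ⟨bdryMap g⁻¹ η, ?_, bdryMap_bdryMap_inv g η⟩
    have := mixedProd_bdryMap g x (bdryMap g⁻¹ η) z
    rw [bdryMap_bdryMap_inv] at this
    exact this.symm.le.trans hη

/-- If a sequence of points and its image under an isometry have unbounded Gromov products, then
the isometry fixes the boundary point that the sequence represents. -/
lemma bdryMap_eq_self_of_tendsto {o : X} {g : X ≃ᵢ X} {x : GromovSeq X}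
    (h : Tendsto (fun n => gromovProd o (x.1 n) (g (x.1 n))) atTop atTop) :
    bdryMap g x.toBoundary = x.toBoundary := by
  rw [bdryMap_toBoundary, eq_comm, toBoundary_eq_iff]
  exact fun z => tendsto_gromovProd_base h z

/-- If two isometries have no common fixed point on the boundary then, given two points `x` and `y`,
one of these isometries, or the identity, moves `y` out of the direction of `x`. -/
lemma exists_gromovProd_le_of_no_common_fixedPoint [ProperSpace X] (hgeod : IsGeodesicSpace X)
    (o : X) (g₁ g₂ : X ≃ᵢ X) (hfix : ∀ ξ : Boundary X, ¬ (bdryMap g₁ ξ = ξ ∧ bdryMap g₂ ξ = ξ)) :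
    ∃ c : ℝ, ∀ x y : X, gromovProd o x y ≤ c ∨ gromovProd o x (g₁ y) ≤ c ∨
      gromovProd o x (g₂ y) ≤ c := by
  obtain ⟨C, hC⟩ := exists_isHyperbolicConst X
  by_contra! hcon
  choose x y h0 h1 h2 using fun n : ℕ => hcon n
  have hy : Tendsto (fun n => dist o (y n)) atTop atTop :=
    tendsto_atTop_mono (fun n => by
      rw [dist_comm]
      exact (h0 n).le.trans (gromovProd_le_dist_right _ _ _)) tendsto_natCast_atTop_atTop
  obtain ⟨φ, hφ, hG⟩ := exists_isGromovSeq_comp hgeod o y hy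
  -- Both `y` and `g y` lie in the direction of `x`, so their mutual product is unbounded and `g`
  -- fixes the limit of `y`.
  have key : ∀ g : X ≃ᵢ X, (∀ n : ℕ, (n : ℝ) < gromovProd o (x n) (g (y n))) →
      bdryMap g (GromovSeq.toBoundary ⟨_, hG⟩) = GromovSeq.toBoundary ⟨_, hG⟩ := fun g hg => by
    refine bdryMap_eq_self_of_tendsto (o := o) (tendsto_atTop_mono (fun n => ?_)
      (tendsto_atTop_add_const_right atTop (-C) tendsto_natCast_atTop_atTop))
    have hn : (n : ℝ) ≤ φ n := Nat.cast_le.2 (hφ n)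
    have := hC.le_of_le (a := n) (w := o) (x := y (φ n)) (y := x (φ n)) (z := g (y (φ n)))
      (by rw [gromovProd_comm]; exact hn.trans (h0 _).le) (hn.trans (hg _).le)
    linarith
  exact hfix _ ⟨key g₁ h1, key g₂ h2⟩

end Boundary

/-! ### Limit points of quasiconvex-cocompact groups -/

section LimitSet

variable {X : Type*} [MetricSpace X] [HyperbolicSpace X]

lemma dist_inv_apply {X : Type*} [MetricSpace X] (g : X ≃ᵢ X) (x y : X) :
    dist (g⁻¹ x) y = dist x (g y) := by
  rw [← g.dist_eq, IsometryEquiv.apply_inv_self]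

/-- For a quasiconvex-cocompact group every limit point is a uniformly radial limit point. -/
lemma IsQuasiconvexCocompact.limitSet_subset {o : X} {G : Subgroup (X ≃ᵢ X)}
    (hqc : IsQuasiconvexCocompact o G) (hgeod : IsGeodesicSpace X) (hdisc : IsStronglyDiscrete o G) :
    limitSet o G ⊆ uniformlyRadialLimitSet o G := by
  obtain ⟨C, hC⟩ := exists_isHyperbolicConst X
  obtain ⟨ρ, hρ, hqc⟩ := hqc
  rintro ξ ⟨g, hgG, hconv⟩
  have hC0 := hC.1
  choose S hS using fun n => hgeod o (g n o)
  have hk : ∀ n j : ℕ, ∃ k ∈ G, ∃ p ∈ S n, dist o p = min (j : ℝ) (dist o (g n o)) ∧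
      dist p (k o) ≤ ρ := fun n j => by
    obtain ⟨p, hpS, hp⟩ := (hS n).exists_dist_eq (t := min (j : ℝ) (dist o (g n o)))
      (le_min (Nat.cast_nonneg j) dist_nonneg) (min_le_right _ _)
    obtain ⟨k, hkG, hk⟩ := mem_iUnion₂.1 (hqc 1 G.one_mem (g n) (hgG n) (S n) (hS n) hpS)
    exact ⟨k, hkG, p, hpS, hp, hk⟩
  have hfar : ∀ j : ℕ, ∀ᶠ n in (hyperfilter ℕ : Filter ℕ), (j : ℝ) ≤ dist o (g n o) := fun j =>
    Nat.hyperfilter_le_atTop ((hconv.eventually_ge_atTop (j : ℝ)).mono fun n hn => by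
      rw [dist_comm]
      exact hn.trans (mixedProd_le_dist _ _ _))
  choose k hkG p hpS hp1 hp3 using hk
  -- By strong discreteness `k n j` takes finitely many values for fixed `j`, so it is constant
  -- along the ultrafilter. Any finite number of relations among the `a j` can thus be read off at
  -- one common `n`.
  have hlim : ∀ j : ℕ, ∃ a ∈ {h : X ≃ᵢ X | h ∈ G ∧ dist o (h o) ≤ j + ρ},
      ∀ᶠ n in (hyperfilter ℕ : Filter ℕ), k n j = a := fun j => by
    refine (Ultrafilter.eventually_exists_mem_iff (hdisc (j + ρ) (by positivity))).1
      (Eventually.of_forall fun n => ⟨k n j, ⟨hkG n j, ?_⟩, rfl⟩)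
    linarith [dist_triangle o (p n j) (k n j o), hp1 n j, hp3 n j,
      min_le_left (j : ℝ) (dist o (g n o))]
  choose a haG ha using hlim
  obtain ⟨u, hu, huξ⟩ := hconv.exists_gromovSeq
  have hu' : ∀ n, u.1 n = g n o := fun n => congrFun hu n
  have hshadow : ∀ j, mixedProd (a j o) ξ o ≤ ρ + (C + 1) := fun j => by
    obtain ⟨n, hn1, hn2⟩ := ((ha j).and
      (Nat.hyperfilter_le_atTop (hC.eventually_abs_sub_le huξ (a j o) o))).exists
    rw [hu', abs_le] at hn2
    have h1 := (hS n).dist_add_dist (hpS n j)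
    have h2 := hp3 n j
    rw [hn1] at h2
    have h3 : gromovProd (a j o) (g n o) o ≤ ρ := by
      unfold gromovProd
      linarith [dist_triangle (g n o) (p n j) (a j o), dist_triangle o (p n j) (a j o),
        dist_comm (g n o) (p n j), dist_comm (g n o) o]
    linarith [hn2.1]
  have hdist : ∀ j : ℕ, (j : ℝ) - ρ ≤ dist o (a j o) := fun j => by
    obtain ⟨n, hn1, hn2⟩ := ((ha j).and (hfar j)).exists
    have h1 := hp1 n j
    have h2 := hp3 n j
    rw [min_eq_left hn2] at h1
    rw [hn1] at h2
    linarith [dist_triangle_right o (p n j) (a j o)]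
  have hstep : ∀ j : ℕ, dist (a j o) (a (j + 1) o) ≤ 2 * ρ + 1 := fun j => by
    obtain ⟨n, ⟨hn1, hn2⟩, hn3⟩ := (((ha j).and (ha (j + 1))).and (hfar (j + 1))).exists
    have h1 := hp3 n j
    have h2 := hp3 n (j + 1)
    have h3 := (hS n).dist_eq_abs (hpS n j) (hpS n (j + 1))
    push_cast at hn3
    rw [hp1, hp1, min_eq_left (by linarith), min_eq_left (by push_cast; linarith), Nat.cast_add,
      Nat.cast_one, sub_add_cancel_left, abs_neg, abs_one] at h3
    rw [hn1] at h1
    rw [hn2] at h2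
    linarith [dist_triangle4 (a j o) (p n j) (p n (j + 1)) (a (j + 1) o),
      dist_comm (a j o) (p n j)]
  have hconv' : ConvergesTo o (fun j => a j o) ξ := by
    refine tendsto_atTop_mono (fun j => ?_) (tendsto_atTop_add_const_right atTop
      (-(ρ + (ρ + (C + 1)) + 2 * (C + 1))) tendsto_natCast_atTop_atTop)
    have h := abs_le.1 (hC.abs_mixedProd_add_sub_dist_le ξ o (a j o))
    linarith [h.1, hshadow j, hdist j]
  -- The identity is put in front because the sequence must start at `o`, while `a 0 o` is only
  -- within `ρ` of it.
  refine ⟨fun n => Nat.casesOn n 1 a, fun n => ?_, 2 * ρ + C + 1, by positivity, ?_, fun n => ?_,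
    fun n => ?_, rfl⟩
  · cases n with
    | zero => exact G.one_mem
    | succ n => exact (haG n).1
  · exact (tendsto_add_atTop_iff_nat 1).1 hconv'
  · cases n with
    | zero =>
      refine (mixedProd_le_dist _ _ _).trans (le_of_eq_of_le (dist_self o) (by positivity))
    | succ n => exact (hshadow n).trans (by linarith)
  · cases n with
    | zero =>
      refine (haG 0).2.trans ?_
      push_cast
      linarith
    | succ n => exact (hstep n).trans (by linarith)

end LimitSet

/-! ### The shadow lemma -/

section ShadowLemma

variable {X : Type*} [MetricSpace X] [HyperbolicSpace X]

lemma isometryDeriv_rpow {b : ℝ} (hb : 1 < b) (o : X) (g : X ≃ᵢ X) (ξ : Boundary X) (s : ℝ) :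
    isometryDeriv b o g ξ ^ s = b ^ (busemann ξ o (g⁻¹ o) * s) :=
  (Real.rpow_mul (zero_le_one.trans hb.le) _ _).symm

lemma neg_dist_le_busemann (ξ : Boundary X) (o : X) (g : X ≃ᵢ X) :
    -dist o (g o) ≤ busemann ξ o (g⁻¹ o) := by
  have h := mixedProd_le_dist (g⁻¹ o) ξ o
  rw [dist_comm, dist_inv_apply] at h
  unfold busemann
  linarith [mixedProd_nonneg o ξ (g⁻¹ o)]

/-- One product is at most `σ` and the two add up to `dist o (g o)` up to `2 * (C + 1)`. With
`neg_dist_le_busemann`, the derivative of `g` is comparable to `b ^ (-dist o (g o))` on `shadow (g⁻¹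
o) o σ`. -/
lemma IsHyperbolicConst.busemann_le {C σ : ℝ} (hC : IsHyperbolicConst X C) {ξ : Boundary X} {o : X}
    {g : X ≃ᵢ X} (hξ : mixedProd o ξ (g⁻¹ o) ≤ σ) :
    busemann ξ o (g⁻¹ o) ≤ 2 * σ + 2 * (C + 1) - dist o (g o) := by
  have h := (abs_le.1 (hC.abs_mixedProd_add_sub_dist_le ξ o (g⁻¹ o))).1
  rw [dist_comm o, dist_inv_apply] at h
  unfold busemann
  linarith

/-- A nonzero quasiconformal measure is not carried by a single boundary point, unless the group
fixes that point. -/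
lemma IsQuasiconformal.bdryMap_eq_of_measure_compl_singleton {b s : ℝ} (hb : 1 < b) {o : X}
    {G : Subgroup (X ≃ᵢ X)} {μ : Measure (Boundary X)} (hμ0 : μ ≠ 0)
    (hμ : IsQuasiconformal b o G s μ) {p : Boundary X} (hp : MeasurableSet {p})
    (hpc : μ {p}ᶜ = 0) {g : X ≃ᵢ X} (hg : g ∈ G) : bdryMap g p = p := by
  obtain ⟨C, hC⟩ := hμ
  have hpos : μ {p} ≠ 0 := fun h => hμ0 <| Measure.measure_univ_eq_zero.1 <| by
    rw [← union_compl_self {p}]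
    exact measure_union_null h hpc
  by_contra hne
  have h := (hC g hg {p} hp).2
  -- The image of the atom is null, although the positive derivative has a positive integral over
  -- the atom.
  have hnull : μ (bdryMap g '' {p}) = 0 := by
    rw [image_singleton]
    exact measure_mono_null (singleton_subset_iff.2 hne) hpc
  rw [hnull, mul_zero, nonpos_iff_eq_zero, setLIntegral_congr_fun (g := fun _ =>
    ENNReal.ofReal (isometryDeriv b o g p ^ s)) hp (by rintro ξ rfl; rfl), setLIntegral_const,
    mul_eq_zero, or_iff_left hpos, ENNReal.ofReal_eq_zero, isometryDeriv_rpow hb] at h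
  exact absurd h (not_le.2 (Real.rpow_pos_of_pos (zero_lt_one.trans hb) _))

/-- A quasiconformal measure cannot be concentrated in one direction. -/
lemma IsQuasiconformal.exists_le_measure_mixedProd_le {b s : ℝ} (hb : 1 < b) {o : X}
    {G : Subgroup (X ≃ᵢ X)} {μ : Measure (Boundary X)} (hμ0 : μ ≠ 0)
    (hμ : IsQuasiconformal b o G s μ)
    (hfix : ∀ ξ : Boundary X, ∃ g ∈ G, bdryMap g ξ ≠ ξ) :
    ∃ σ : ℝ, 0 ≤ σ ∧ ∃ ε : ℝ≥0∞, ε ≠ 0 ∧ ∀ y : X, ε ≤ μ (shadow y o σ) := by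
  by_contra! hcon
  -- Borel–Cantelli: with summable measures, almost every `ξ` is eventually outside `shadow (y n) o
  -- n`, so `y` converges to `ξ`. Limits are unique, hence `μ` is carried by one point, which `G`
  -- would have to fix.
  obtain ⟨ε, hε, hεsum⟩ := ENNReal.exists_pos_sum_of_countable' (ε := 1) one_ne_zero ℕ
  choose y hy using fun n : ℕ => hcon n n.cast_nonneg (ε n) (hε n).ne'
  have hsum : ∑' n, μ (shadow (y n) o n) ≠ ∞ :=
    ((ENNReal.tsum_le_tsum fun n => (hy n).le).trans_lt (hεsum.trans ENNReal.one_lt_top)).ne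
  have hae := ae_eventually_notMem hsum
  have hconv : ∀ ξ : Boundary X, (∀ᶠ n in atTop, ξ ∉ shadow (y n) o n) → ConvergesTo o y ξ :=
    fun ξ hξ => tendsto_atTop_mono' atTop (hξ.mono fun n hn => (not_le.1 hn).le)
      tendsto_natCast_atTop_atTop
  have : (ae μ).NeBot := ae_neBot.2 hμ0
  obtain ⟨p, hp⟩ := hae.exists
  have hset : {ξ | ∀ᶠ n in atTop, ξ ∉ shadow (y n) o n} = {p} := by
    ext ξ
    refine ⟨fun hξ => eq_of_tendsto_mixedProd (hconv ξ hξ) (hconv p hp), ?_⟩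
    rintro rfl
    exact hp
  -- The description of `{p}` through countably many closed shadows shows that it is Borel.
  have hmeas : MeasurableSet {p} := by
    rw [← hset]
    simp only [eventually_atTop, ofPred_exists, ofPred_forall]
    exact MeasurableSet.iUnion fun N => MeasurableSet.iInter fun n => MeasurableSet.iInter fun _ =>
      (measurableSet_shadow _ _ _).compl
  obtain ⟨g, hg, hgp⟩ := hfix p
  refine hgp (hμ.bdryMap_eq_of_measure_compl_singleton hb hμ0 hmeas ?_ hg)
  rw [← hset]
  exact hae

/-- Quasiconformality is applied to this set: its mass is bounded below uniformly in `g` for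
suitable `σ`, and its image is the shadow to be measured. -/
lemma bdryMap_image_shadow_inv (g : X ≃ᵢ X) (o : X) (σ : ℝ) :
    bdryMap g '' shadow (g⁻¹ o) o σ = shadow o (g o) σ := by
  rw [bdryMap_image_shadow, IsometryEquiv.apply_inv_self]

/-- The lower bound in Sullivan's shadow lemma. -/
lemma IsQuasiconformal.exists_le_measure_shadow {b s : ℝ} (hb : 1 < b) (hs : 0 ≤ s) {o : X}
    {G : Subgroup (X ≃ᵢ X)} {μ : Measure (Boundary X)} [IsFiniteMeasure μ] (hμ0 : μ ≠ 0)
    (hμ : IsQuasiconformal b o G s μ)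
    (hfix : ∀ ξ : Boundary X, ∃ g ∈ G, bdryMap g ξ ≠ ξ) :
    ∃ σ : ℝ, 0 ≤ σ ∧ ∃ c : ℝ≥0∞, c ≠ ∞ ∧ ∀ g ∈ G,
      ENNReal.ofReal (b ^ (-dist o (g o) * s)) ≤ c * μ (shadow o (g o) σ) := by
  obtain ⟨σ, hσ, ε, hε, hεμ⟩ := hμ.exists_le_measure_mixedProd_le hb hμ0 hfix
  obtain ⟨C, hC⟩ := hμ
  have hε' : ε⁻¹ ≠ ∞ := ENNReal.inv_ne_top.2 hε
  have hεtop : ε ≠ ∞ := ne_top_of_le_ne_top (measure_ne_top μ _) (hεμ o)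
  refine ⟨σ, hσ, C * ε⁻¹, ENNReal.mul_ne_top ENNReal.coe_ne_top hε', fun g hg => ?_⟩
  have h := (hC g hg _ (measurableSet_shadow (g⁻¹ o) o σ)).2
  rw [bdryMap_image_shadow_inv] at h
  have h2 : ENNReal.ofReal (b ^ (-dist o (g o) * s)) * ε ≤ C * μ (shadow o (g o) σ) := by
    refine le_trans (mul_le_mul_right (hεμ (g⁻¹ o)) _) (le_trans ?_ h)
    rw [← setLIntegral_const]
    refine setLIntegral_mono' (measurableSet_shadow _ _ _) fun ξ _ => ?_
    rw [isometryDeriv_rpow hb]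
    exact ENNReal.ofReal_le_ofReal (Real.rpow_le_rpow_of_exponent_le hb.le
      (mul_le_mul_of_nonneg_right (neg_dist_le_busemann ξ o g) hs))
  rw [mul_right_comm, ← div_eq_mul_inv]
  exact (ENNReal.le_div_iff_mul_le (Or.inl hε) (Or.inl hεtop)).2 h2

/-- The upper bound in Sullivan's shadow lemma. -/
lemma IsQuasiconformal.exists_measure_shadow_le {b s : ℝ} (hb : 1 < b) (hs : 0 ≤ s) {o : X}
    {G : Subgroup (X ≃ᵢ X)} {μ : Measure (Boundary X)} [IsFiniteMeasure μ]
    (hμ : IsQuasiconformal b o G s μ) (σ : ℝ) :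
    ∃ c : ℝ≥0∞, c ≠ ∞ ∧ ∀ g ∈ G,
      μ (shadow o (g o) σ) ≤ c * ENNReal.ofReal (b ^ (-dist o (g o) * s)) := by
  obtain ⟨K, hK⟩ := exists_isHyperbolicConst X
  obtain ⟨C, hC⟩ := hμ
  have hb0 : 0 < b := zero_lt_one.trans hb
  refine ⟨C * (ENNReal.ofReal (b ^ ((2 * σ + 2 * (K + 1)) * s)) * μ univ), ENNReal.mul_ne_top
    ENNReal.coe_ne_top (ENNReal.mul_ne_top ENNReal.ofReal_ne_top (measure_ne_top μ _)),
    fun g hg => ?_⟩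
  have h := (hC g hg _ (measurableSet_shadow (g⁻¹ o) o σ)).1
  rw [bdryMap_image_shadow_inv] at h
  have h2 : ∫⁻ ξ in shadow (g⁻¹ o) o σ, ENNReal.ofReal (isometryDeriv b o g ξ ^ s) ∂μ ≤
      ENNReal.ofReal (b ^ ((2 * σ + 2 * (K + 1)) * s)) *
        ENNReal.ofReal (b ^ (-dist o (g o) * s)) * μ univ := by
    rw [← ENNReal.ofReal_mul (Real.rpow_nonneg hb0.le _), ← Real.rpow_add hb0, ← add_mul]
    refine le_trans ?_ (mul_le_mul_right (measure_mono (subset_univ (shadow (g⁻¹ o) o σ))) _)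
    rw [← setLIntegral_const]
    refine setLIntegral_mono' (measurableSet_shadow _ _ _) fun ξ hξ => ?_
    rw [isometryDeriv_rpow hb]
    exact ENNReal.ofReal_le_ofReal (Real.rpow_le_rpow_of_exponent_le hb.le
      (mul_le_mul_of_nonneg_right ((hK.busemann_le hξ).trans_eq (sub_eq_add_neg _ _)) hs))
  refine h.trans ((mul_le_mul_right h2 _).trans_eq ?_)
  ring

end ShadowLemma

/-! ### Holes -/

/-- Suppose that sets `S i`, sorted into levels, contain sets `H i` of comparable measure that are
disjoint from the sets of all later levels and overlap boundedly within a level. Then the set of the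
points covered at every level is a null set. -/
lemma measure_eq_zero_of_holes {α ι : Type*} [MeasurableSpace α] {μ : Measure α} [IsFiniteMeasure μ]
    {V : ℕ → Finset ι} {S H : ι → Set α} {c : ℝ≥0∞} (hc : c ≠ ∞) {κ : ℕ}
    (hH : ∀ i, MeasurableSet (H i))
    (hle : ∀ N, ∀ i ∈ V N, μ (S i) ≤ c * μ (H i))
    (hsub : ∀ N, ∀ i ∈ V N, H i ⊆ S i)
    (hdisj : ∀ M N, M < N → ∀ i ∈ V M, ∀ j ∈ V N, Disjoint (H i) (S j))
    (hκ : ∀ N, ∀ T ⊆ V N, ∀ a, (∀ i ∈ T, a ∈ H i) → T.card ≤ κ)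
    {A : Set α} (hA : ∀ N, A ⊆ ⋃ i ∈ V N, S i) : μ A = 0 := by
  classical
  have hmeas : ∀ N, MeasurableSet (⋃ i ∈ V N, H i) := fun N =>
    Finset.measurableSet_biUnion _ fun i _ => hH i
  have hlt : ∀ M N, M < N → Disjoint (⋃ i ∈ V M, H i) (⋃ i ∈ V N, H i) := fun M N h => by
    simp only [disjoint_iUnion_left, disjoint_iUnion_right]
    exact fun j hj i hi => (hdisj M N h i hi j hj).mono_right (hsub N j hj)
  -- Integrate the counting function of the sets `H i`, which is at most `κ` on their union and
  -- vanishes outside.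
  have hsum : ∀ N, ∑ i ∈ V N, μ (H i) ≤ κ * μ (⋃ i ∈ V N, H i) := fun N => by
    calc ∑ i ∈ V N, μ (H i) = ∑ i ∈ V N, ∫⁻ a, (H i).indicator 1 a ∂μ := by
          simp only [lintegral_indicator_one (hH _)]
      _ = ∫⁻ a, ∑ i ∈ V N, (H i).indicator 1 a ∂μ :=
          (lintegral_finsetSum _ fun i _ => measurable_one.indicator (hH i)).symm
      _ ≤ ∫⁻ a, (⋃ i ∈ V N, H i).indicator (fun _ => (κ : ℝ≥0∞)) a ∂μ := by
          refine lintegral_mono fun a => ?_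
          by_cases ha : a ∈ ⋃ i ∈ V N, H i
          · rw [indicator_of_mem ha]
            simp only [indicator_apply, Pi.one_apply, Finset.sum_boole]
            exact Nat.cast_le.2 (hκ N _ (Finset.filter_subset _ _) a fun i hi =>
              (Finset.mem_filter.1 hi).2)
          · refine (Finset.sum_eq_zero fun i hi => indicator_of_notMem (fun h => ha ?_) _).trans_le
              zero_le
            exact mem_iUnion₂.2 ⟨i, hi, h⟩
      _ = κ * μ (⋃ i ∈ V N, H i) := lintegral_indicator_const (hmeas N) _
  have hcover : ∀ N, μ A ≤ c * κ * μ (⋃ i ∈ V N, H i) := fun N =>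
    calc μ A ≤ ∑ i ∈ V N, μ (S i) := (measure_mono (hA N)).trans (measure_biUnion_finset_le _ _)
      _ ≤ ∑ i ∈ V N, c * μ (H i) := Finset.sum_le_sum (hle N)
      _ = c * ∑ i ∈ V N, μ (H i) := Finset.mul_sum _ _ _ |>.symm
      _ ≤ c * (κ * μ (⋃ i ∈ V N, H i)) := mul_le_mul_right (hsum N) _
      _ = c * κ * μ (⋃ i ∈ V N, H i) := (mul_assoc _ _ _).symm
  have htsum : ∑' N, μ (⋃ i ∈ V N, H i) ≠ ∞ :=
    ((tsum_meas_le_meas_iUnion_of_disjoint μ hmeas fun M N h => by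
      rcases h.lt_or_gt with h | h
      · exact hlt M N h
      · exact (hlt N M h).symm).trans_lt (measure_lt_top μ _)).ne
  have hlim := ENNReal.Tendsto.const_mul (ENNReal.tendsto_atTop_zero_of_tsum_ne_top htsum)
    (Or.inr (ENNReal.mul_ne_top hc (ENNReal.natCast_ne_top κ)))
  rw [mul_zero] at hlim
  exact nonpos_iff_eq_zero.1 (ge_of_tendsto' hlim hcover)

/-! ### Tracked orbit points and gaps in the orbit -/

section Radial

variable {X : Type*} [MetricSpace X] [HyperbolicSpace X]

/-- Every point between `o` and `x` lies within distance `R` of the orbit of `o`. -/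
def IsTracked (o : X) (G : Subgroup (X ≃ᵢ X)) (R : ℝ) (x : X) : Prop :=
  ∀ p, dist o p + dist p x = dist o x → ∃ k ∈ G, dist p (k o) ≤ R

/-- A point whose shadow contains `ξ` is almost on the way from `o` to `ξ`, so its product with `ξ`
is nearly the maximal value `dist o x`. -/
lemma IsHyperbolicConst.le_mixedProd_of_mem_shadow {C σ : ℝ} (hC : IsHyperbolicConst X C)
    {ξ : Boundary X} {o x : X} (h : ξ ∈ shadow o x σ) :
    dist o x - σ - 2 * (C + 1) ≤ mixedProd o ξ x := by
  have h1 := (abs_le.1 (hC.abs_mixedProd_add_sub_dist_le ξ o x)).1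
  have h2 : mixedProd x ξ o ≤ σ := h
  linarith

/-- The points of a uniformly radially convergent sequence are tracked. -/
lemma ConvergesUniformlyRadially.isTracked {C σ : ℝ} (hC : IsHyperbolicConst X C) (hσ : 0 ≤ σ)
    {o : X} {G : Subgroup (X ≃ᵢ X)} {g : ℕ → X ≃ᵢ X} (hg : ∀ n, g n ∈ G) {η : Boundary X}
    (h : ConvergesUniformlyRadially o σ (fun n => g n o) η) (n : ℕ) :
    IsTracked o G (3 * σ + 10 * C + 6) (g n o) := by
  obtain ⟨-, hsh, hstep, h0⟩ := h
  intro p hp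
  have hpn : dist o p ≤ dist o (g n o) := by linarith [dist_nonneg (x := p) (y := g n o)]
  obtain ⟨i, hi1, hi2⟩ := exists_dist_mem_Icc (a := fun n => g n o) h0 dist_nonneg hσ hstep hpn
  refine ⟨g i, hg i, ?_⟩
  have h1 := hC.le_mixedProd_of_mem_shadow (hsh i)
  have h2 := hC.le_mixedProd_of_mem_shadow (hsh n)
  -- Both `g n o` and `g i o` point towards `η`; since `p` and `g i o` are at about the same
  -- distance from `o`, a large product makes them close.
  have h3 := hC.le_gromovProd_of_le_mixedProd (a := dist o p - σ - 2 * (C + 1)) (w := o)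
    (x := g n o) (y := g i o) (by linarith) (by linarith)
  have h0C := hC.1
  have h4 := hC.le_of_le (a := dist o p - σ - 2 * (C + 1) - (2 * C + 1)) (w := o) (x := p)
    (y := g n o) (z := g i o) (by rw [gromovProd_eq_dist hp]; linarith) h3
  unfold gromovProd at h4
  rw [dist_comm p o, dist_comm (g i o) o] at h4
  linarith

/-- If `w` and a tracked point `x` farther out cast shadows with a common point, then the points
almost between `o` and `w` are close to the orbit of `o`. -/
lemma IsHyperbolicConst.exists_dist_le_of_isTracked {C c σ R : ℝ} (hC : IsHyperbolicConst X C)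
    (hgeod : IsGeodesicSpace X) (hc : 0 ≤ c) (hσ : 0 ≤ σ) {o q w x : X} {G : Subgroup (X ≃ᵢ X)}
    {η : Boundary X} (hx : IsTracked o G R x) (hq : gromovProd q o w ≤ c) (hηw : η ∈ shadow o w σ)
    (hηx : η ∈ shadow o x σ) (hqx : dist o q ≤ dist o x) (hwx : dist o w ≤ dist o x) :
    ∃ k ∈ G, dist q (k o) ≤ R + 2 * (c + σ + 6 * C + 3) := by
  have h0C := hC.1
  have h1 := hC.le_mixedProd_of_mem_shadow hηw
  have h2 := hC.le_mixedProd_of_mem_shadow hηx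
  have h3 := hC.le_gromovProd_of_le_mixedProd (a := dist o w - σ - 2 * (C + 1)) (w := o)
    (x := w) (y := x) (by linarith) (by linarith)
  have h4 : gromovProd o q w = dist o q - gromovProd q o w := by
    unfold gromovProd
    rw [dist_comm q o, dist_comm w o, dist_comm w q]
    ring
  have h5 := gromovProd_le_dist_right o q w
  rw [dist_comm w o] at h5
  have h6 := hC.le_of_le (a := dist o q - c - σ - 2 * (C + 1) - (2 * C + 1)) (w := o) (x := q)
    (y := w) (z := x) (by linarith) (by linarith)
  obtain ⟨S, hS⟩ := hgeod o x
  -- The comparison point is on the segment to `x`, at the same distance from `o` as `q`. Tracking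
  -- places it near the orbit.
  obtain ⟨p, hpS, hp⟩ := hS.exists_dist_eq dist_nonneg hqx
  have hpx := hS.dist_add_dist hpS
  have h7 := hC.le_of_le (a := dist o q - c - σ - 2 * (C + 1) - (2 * C + 1) - C) (w := o) (x := q)
    (y := x) (z := p) h6 (by rw [gromovProd_comm, gromovProd_eq_dist hpx]; linarith)
  obtain ⟨k, hk, hpk⟩ := hx p hpx
  refine ⟨k, hk, ?_⟩
  unfold gromovProd at h7
  rw [dist_comm q o, dist_comm p o] at h7
  linarith [dist_triangle q p (k o)]

/-- Points at about the same distance from `o` whose shadows meet are close to each other. -/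
lemma IsHyperbolicConst.dist_le_of_mem_shadow {C σ τ t : ℝ} (hC : IsHyperbolicConst X C)
    {o x y : X} {η : Boundary X} (hx : η ∈ shadow o x σ) (hy : η ∈ shadow o y σ)
    (hx1 : t ≤ dist o x) (hx2 : dist o x ≤ t + τ) (hy1 : t ≤ dist o y) (hy2 : dist o y ≤ t + τ) :
    dist x y ≤ 2 * τ + 2 * σ + 8 * C + 6 := by
  have h1 := hC.le_mixedProd_of_mem_shadow hx
  have h2 := hC.le_mixedProd_of_mem_shadow hy
  have h3 := hC.le_gromovProd_of_le_mixedProd (a := t - σ - 2 * (C + 1)) (w := o)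
    (x := x) (y := y) (by linarith) (by linarith)
  unfold gromovProd at h3
  rw [dist_comm x o, dist_comm y o] at h3
  linarith

/-- If `z` is almost between `o` and `w`, then the shadow of `w` is contained in a shadow of `z`. -/
lemma IsHyperbolicConst.shadow_subset_shadow {C c σ : ℝ} (hC : IsHyperbolicConst X C)
    (hσ : 0 ≤ σ) {o z w : X} (h : gromovProd z o w ≤ c) :
    shadow o w σ ⊆ shadow o z (2 * σ + c + 5 * C + 3) := by
  intro η hη
  obtain ⟨u, hu⟩ := exists_toBoundary_eq η
  obtain ⟨n, h1, h2⟩ :=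
    ((hC.eventually_abs_sub_le hu w o).and (hC.eventually_abs_sub_le hu z o)).exists
  have h3 : mixedProd w η o ≤ σ := hη
  rw [abs_le] at h1 h2
  show mixedProd z η o ≤ _
  have h0C := hC.1
  have hgp := gromovProd_nonneg z o w
  rcases hC.le_or_le z o (u.1 n) w with h4 | h4
  · rw [gromovProd_comm] at h4
    linarith
  -- Here, seen from `z`, the points `w` and `u n` diverge. Then `z` is almost between `w` and both
  -- `o` and `u n`, so the small product of `o` and `u n` at `w` forces `z` to be near `w`, and the
  -- base point can be changed.
  · have h5 := hC.le_or_le w o z (u.1 n)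
    have e1 : gromovProd w o z = dist z w - gromovProd z o w := by
      unfold gromovProd
      rw [dist_comm w z]
      ring
    have e2 : gromovProd w z (u.1 n) = dist z w - gromovProd z (u.1 n) w := by
      unfold gromovProd
      rw [dist_comm w z, dist_comm z (u.1 n)]
      ring
    have e3 := gromovProd_comm w o (u.1 n)
    have e4 := gromovProd_le_add z w (u.1 n) o
    rcases h5 with h5 | h5 <;> linarith

/-- For a group that is not quasiconvex-cocompact there are points far from the orbit of `o` behind
every point of that orbit, at a bounded distance. -/
lemma exists_holes [ProperSpace X] (hgeod : IsGeodesicSpace X) {o : X} {G : Subgroup (X ≃ᵢ X)}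
    (hgen : IsGeneralType G) (hqc : ¬ IsQuasiconvexCocompact o G) :
    ∃ c : ℝ, 0 ≤ c ∧ ∀ ρ : ℝ, ∃ L : ℝ, 0 ≤ L ∧ ∀ g ∈ G, ∃ j ∈ G, ∃ q : X,
      gromovProd (g o) o (j o) ≤ c ∧ gromovProd q o (j o) ≤ c ∧ dist (g o) (j o) ≤ L ∧
      dist (g o) q ≤ L ∧ ∀ k ∈ G, ρ < dist q (k o) := by
  obtain ⟨g₁, hg₁, g₂, hg₂, -, -, hfix⟩ := hgen
  obtain ⟨c, hc⟩ := exists_gromovProd_le_of_no_common_fixedPoint hgeod o g₁ g₂ hfix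
  set m := max (dist o (g₁ o)) (dist o (g₂ o)) with hm
  have hm0 : 0 ≤ m := le_max_of_le_left dist_nonneg
  refine ⟨max c 0 + m, by positivity, fun ρ => ?_⟩
  unfold IsQuasiconvexCocompact at hqc
  push Not at hqc
  -- The segment and its gap `p` are chosen once for each `ρ`, so `L` does not depend on `g`. The
  -- maximum with 1 provides the positive radius required by the definition.
  obtain ⟨a, ha, a', ha', S, hS, hsub⟩ := hqc (max ρ 1) (lt_max_of_lt_right one_pos)
  obtain ⟨p, hpS, hp⟩ := not_subset.1 hsub
  simp only [mem_iUnion, Metric.mem_closedBall, not_exists, not_le] at hp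
  have hap := hS.dist_add_dist hpS
  refine ⟨m + dist (a o) (a' o), by positivity, fun g hg => ?_⟩
  -- The segment moved to start at `o` is turned by `f` away from `g⁻¹ o`; after applying `g` it
  -- leads from near `g o` away from `o`.
  have hf : ∃ f ∈ G, dist o (f o) ≤ m ∧ gromovProd o (g⁻¹ o) (f (a⁻¹ (a' o))) ≤ c := by
    rcases hc (g⁻¹ o) (a⁻¹ (a' o)) with h | h | h
    · exact ⟨1, G.one_mem, (dist_self o).trans_le hm0, h⟩
    · exact ⟨g₁, hg₁, le_max_left _ _, h⟩
    · exact ⟨g₂, hg₂, le_max_right _ _, h⟩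
  obtain ⟨f, hfG, hfm, hf⟩ := hf
  have hgp : gromovProd (g o) o (g (f (a⁻¹ (a' o)))) ≤ c := by
    have := gromovProd_isometry g (g o) (g⁻¹ o) (f (a⁻¹ (a' o)))
    rw [IsometryEquiv.apply_inv_self, IsometryEquiv.inv_apply_self] at this
    exact this.trans_le hf
  have d1 : dist (g o) (g (f o)) ≤ m := by rwa [g.dist_eq]
  have d2 : dist (g (f o)) (g (f (a⁻¹ p))) = dist (a o) p := by
    rw [g.dist_eq, f.dist_eq, dist_comm, dist_inv_apply, dist_comm]
  have d3 : dist (g (f (a⁻¹ p))) (g (f (a⁻¹ (a' o)))) = dist p (a' o) := by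
    rw [g.dist_eq, f.dist_eq, dist_inv_apply, IsometryEquiv.apply_inv_self]
  have d4 : dist (g (f o)) (g (f (a⁻¹ (a' o)))) = dist (a o) (a' o) := by
    rw [g.dist_eq, f.dist_eq, dist_comm, dist_inv_apply, dist_comm]
  refine ⟨g * (f * (a⁻¹ * a')), G.mul_mem hg (G.mul_mem hfG (G.mul_mem (G.inv_mem ha) ha')),
    g (f (a⁻¹ p)), ?_, ?_, ?_, ?_, fun k hk => ?_⟩
  · exact hgp.trans ((le_max_left c 0).trans (le_add_of_nonneg_right hm0))
  · show gromovProd _ o (g (f (a⁻¹ (a' o)))) ≤ _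
    unfold gromovProd at hgp ⊢
    have t1 := dist_triangle4 o (g o) (g (f o)) (g (f (a⁻¹ p)))
    have t2 := dist_triangle_left (g (f o)) (g (f (a⁻¹ (a' o)))) (g o)
    rw [dist_comm (g (f (a⁻¹ (a' o)))) (g (f (a⁻¹ p)))]
    rw [dist_comm (g (f (a⁻¹ (a' o)))) (g o)] at hgp
    linarith [le_max_left c 0]
  · show dist (g o) (g (f (a⁻¹ (a' o)))) ≤ _
    linarith [dist_triangle (g o) (g (f o)) (g (f (a⁻¹ (a' o))))]
  · linarith [dist_triangle (g o) (g (f o)) (g (f (a⁻¹ p))), dist_nonneg (x := p) (y := a' o)]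
  · have h := hp (a * (f⁻¹ * (g⁻¹ * k)))
      (G.mul_mem ha (G.mul_mem (G.inv_mem hfG) (G.mul_mem (G.inv_mem hg) hk)))
    have e : dist p ((a * (f⁻¹ * (g⁻¹ * k))) o) = dist (g (f (a⁻¹ p))) (k o) := by
      show dist p (a (f⁻¹ (g⁻¹ (k o)))) = _
      rw [← dist_inv_apply, dist_comm, dist_inv_apply, dist_inv_apply, dist_comm]
    rw [← e]
    exact (le_max_left ρ 1).trans_lt h

/-- If the group is not quasiconvex-cocompact, then the `σ`-uniformly radial limit points form a
null set. -/
lemma IsQuasiconformal.measure_convergesUniformlyRadially_eq_zero [ProperSpace X]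
    (hgeod : IsGeodesicSpace X) {b s : ℝ} (hb : 1 < b) (hs : 0 ≤ s) {o : X}
    {G : Subgroup (X ≃ᵢ X)} (hdisc : IsStronglyDiscrete o G) (hgen : IsGeneralType G)
    {μ : Measure (Boundary X)} [IsFiniteMeasure μ] (hμ0 : μ ≠ 0)
    (hμ : IsQuasiconformal b o G s μ) (hqc : ¬ IsQuasiconvexCocompact o G) {σ : ℝ} (hσ : 0 < σ) :
    μ {η | ∃ g : ℕ → X ≃ᵢ X, (∀ n, g n ∈ G) ∧
      ConvergesUniformlyRadially o σ (fun n => g n o) η} = 0 := by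
  obtain ⟨C, hC⟩ := exists_isHyperbolicConst X
  have h0C := hC.1
  have hfix : ∀ ξ : Boundary X, ∃ g ∈ G, bdryMap g ξ ≠ ξ := fun ξ => by
    obtain ⟨g₁, hg₁, g₂, hg₂, -, -, h⟩ := hgen
    by_contra! hcon
    exact h ξ ⟨hcon g₁ hg₁, hcon g₂ hg₂⟩
  obtain ⟨σ₀, hσ₀, c₀, hc₀, hlow⟩ := hμ.exists_le_measure_shadow hb hs hμ0 hfix
  obtain ⟨c, hc, hholes⟩ := exists_holes hgeod hgen hqc
  -- Large enough for the shadow of `g o` to contain both the hole (by `shadow_subset_shadow`) and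
  -- the `σ`-shadow. It depends on `c` but not on `ρ`, so the gap radius can be fixed afterwards.
  set σ₁ := 2 * σ₀ + c + 5 * C + 3 + σ with hσ₁
  set R := 3 * σ + 10 * C + 6 with hR
  obtain ⟨c₁, hc₁, hup⟩ := hμ.exists_measure_shadow_le hb hs σ₁
  obtain ⟨L, hL, hj⟩ := hholes (R + 2 * (c + σ₁ + 6 * C + 3))
  have hmono : ∀ {τ τ' : ℝ} (x : X), τ ≤ τ' → shadow o x τ ⊆ shadow o x τ' :=
    fun x h η hη => le_trans hη h
  have hmul : ∀ {M N : ℕ}, M < N → M * (σ + L) + (σ + L) ≤ N * (σ + L) := fun {M N} h => by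
    have h' : (M : ℝ) + 1 ≤ N := by exact_mod_cast h
    nlinarith
  have : Nonempty X := ⟨o⟩
  choose! j hjG q hq1 hq2 hq3 hq4 hq5 using hj
  -- A level has width `σ`, so no sequence with steps at most `σ` can skip it; the spacing `σ + L`
  -- puts later levels beyond the gaps of earlier ones.
  have hfin : ∀ N : ℕ, {g : X ≃ᵢ X | g ∈ G ∧ N * (σ + L) ≤ dist o (g o) ∧
      dist o (g o) ≤ N * (σ + L) + σ ∧ IsTracked o G R (g o)}.Finite := fun N =>
    (hdisc (N * (σ + L) + σ) (by positivity)).subset fun g hg => ⟨hg.1, hg.2.2.1⟩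
  have hsub : ∀ g ∈ G, shadow o (j g o) σ₀ ⊆ shadow o (g o) σ₁ := fun g hg =>
    (hC.shadow_subset_shadow hσ₀ (hq1 g hg)).trans (hmono _ (by linarith))
  have hball := hdisc (2 * σ + 2 * σ₁ + 8 * C + 6) (by positivity)
  refine measure_eq_zero_of_holes (V := fun N => (hfin N).toFinset)
    (S := fun g => shadow o (g o) σ₁) (H := fun g => shadow o (j g o) σ₀)
    (c := c₁ * ENNReal.ofReal (b ^ (L * s)) * c₀) (κ := hball.toFinset.card)
    (ENNReal.mul_ne_top (ENNReal.mul_ne_top hc₁ ENNReal.ofReal_ne_top) hc₀)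
    (fun g => measurableSet_shadow _ _ _) (fun N g hg => ?_) (fun N g hg => ?_)
    (fun M N hMN g hg g' hg' => ?_) (fun N T hT η hη => ?_) (fun N η hη => ?_)
  · obtain ⟨hgG, -⟩ := (hfin N).mem_toFinset.1 hg
    refine (hup g hgG).trans ?_
    rw [mul_assoc, mul_assoc]
    refine mul_le_mul_right (le_trans ?_ (mul_le_mul_right (hlow _ (hjG g hgG)) _)) _
    rw [← ENNReal.ofReal_mul (by positivity), ← Real.rpow_add (by positivity), ← add_mul]
    refine ENNReal.ofReal_le_ofReal (Real.rpow_le_rpow_of_exponent_le hb.le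
      (mul_le_mul_of_nonneg_right ?_ hs))
    linarith [dist_triangle o (g o) (j g o), hq3 g hgG]
  · exact hsub g ((hfin N).mem_toFinset.1 hg).1
  · obtain ⟨hgG, -, hg2, -⟩ := (hfin M).mem_toFinset.1 hg
    obtain ⟨-, hg'1, -, hg'3⟩ := (hfin N).mem_toFinset.1 hg'
    refine disjoint_left.2 fun η hη hη' => ?_
    have hMN' := hmul hMN
    -- A common point of the hole and a later shadow would bring the gap `q g` near the orbit, since
    -- `g' o` is tracked.
    obtain ⟨k, hk, hqk⟩ := hC.exists_dist_le_of_isTracked hgeod hc (by linarith) hg'3 (hq2 g hgG)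
      (hmono _ (by linarith) hη) hη'
      (by linarith [dist_triangle o (g o) (q g), hq4 g hgG])
      (by linarith [dist_triangle o (g o) (j g o), hq3 g hgG])
    exact absurd hqk (not_le.2 (hq5 g hgG k hk))
  · rcases T.eq_empty_or_nonempty with rfl | ⟨g₀, hg₀⟩
    · exact Nat.zero_le _
    -- Overlapping elements of one level have nearby orbit points, so translating by `g₀⁻¹` puts
    -- them all into one finite ball of `G`.
    refine Finset.card_le_card_of_injOn (fun g => g₀⁻¹ * g) (fun g hg => ?_)
      (mul_right_injective _).injOn
    obtain ⟨hgG, hg1, hg2, -⟩ := (hfin N).mem_toFinset.1 (hT hg)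
    obtain ⟨hg₀G, hg₀1, hg₀2, -⟩ := (hfin N).mem_toFinset.1 (hT hg₀)
    refine hball.mem_toFinset.2 ⟨G.mul_mem (G.inv_mem hg₀G) hgG, ?_⟩
    show dist o (g₀⁻¹ (g o)) ≤ _
    rw [dist_comm, dist_inv_apply, dist_comm]
    exact hC.dist_le_of_mem_shadow (hsub g₀ hg₀G (hη g₀ hg₀)) (hsub g hgG (hη g hg))
      hg₀1 hg₀2 hg1 hg2
  · obtain ⟨g, hgG, hrad⟩ := hη
    have htr := hrad.isTracked hC hσ.le hgG
    obtain ⟨hconv, hsh, hstep, h0⟩ := hrad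
    obtain ⟨n, hn⟩ := (hconv.eventually_ge_atTop (N * (σ + L))).exists
    obtain ⟨i, hi1, hi2⟩ := exists_dist_mem_Icc (a := fun n => g n o) (t := N * (σ + L)) h0
      (by positivity) hσ.le hstep (n := n)
      (by rw [dist_comm]; exact hn.trans (mixedProd_le_dist _ _ _))
    exact mem_iUnion₂.2 ⟨g i, (hfin N).mem_toFinset.2 ⟨hgG i, hi1, hi2, htr i⟩,
      hmono _ (by linarith) (hsh i)⟩

lemma ConvergesUniformlyRadially.mono {o : X} {σ τ : ℝ} (hστ : σ ≤ τ) {x : ℕ → X} {ξ : Boundary X}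
    (h : ConvergesUniformlyRadially o σ x ξ) : ConvergesUniformlyRadially o τ x ξ :=
  ⟨h.1, fun n => le_trans (h.2.1 n) hστ, fun n => (h.2.2.1 n).trans hστ, h.2.2.2⟩

end Radial

end Gromov

theorem mainTheorem8 {X : Type*} [MetricSpace X] [Gromov.HyperbolicSpace X] [ProperSpace X]
    (hgeod : Gromov.IsGeodesicSpace X) (o : X)
    (b : ℝ) (hb : 1 < b) (hvis : ∃ D, Gromov.IsVisualMetric b o D)
    (G : Subgroup (X ≃ᵢ X)) (hdisc : Gromov.IsStronglyDiscrete o G) (hgen : Gromov.IsGeneralType G)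
    (δ : NNReal) (hδ : Gromov.poincareExponent b o G = (δ : ENNReal))
    (μ : MeasureTheory.Measure (Gromov.Boundary X)) [MeasureTheory.IsFiniteMeasure μ] (hμ0 : μ ≠ 0)
    (hsupp : μ (Gromov.limitSet o G)ᶜ = 0) (hμ : Gromov.IsQuasiconformal b o G δ μ) :
    μ (Gromov.uniformlyRadialLimitSet o G) = 0 ↔ ¬ Gromov.IsQuasiconvexCocompact o G := by
  refine ⟨fun h hqc => hμ0 ?_, fun hqc => ?_⟩
  · rw [← Measure.measure_univ_eq_zero, ← union_compl_self (Gromov.limitSet o G)]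
    exact measure_union_null (measure_mono_null (hqc.limitSet_subset hgeod hdisc) h) hsupp
  -- The parameter `σ` varies with the limit point, but it may be enlarged to `n + 1`, which leaves
  -- countably many null sets.
  · refine measure_mono_null ?_ (measure_iUnion_null fun n : ℕ =>
      hμ.measure_convergesUniformlyRadially_eq_zero hgeod hb δ.2 hdisc hgen hμ0 hqc
        (σ := n + 1) n.cast_add_one_pos)
    rintro η ⟨g, hgG, σ, -, hrad⟩
    obtain ⟨n, hn⟩ := exists_nat_ge σ
    exact mem_iUnion.2 ⟨n, g, hgG, hrad.mono (by linarith)⟩
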